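/- Let $\Omega\subset\mathbb R^d$, $d\ge 1$, be a bounded domain with Lipschitz boundary, and let $(\varphi_n)_{n\ge1}$ be an orthonormal basis of $L^2(\Omega)$ consisting of eigenfunctions of the Dirichlet Laplacian, $\varphi_n\in H^1_0(\Omega)$ and $-\Delta\varphi_n=\lambda_n\varphi_n$ weakly, with $\lambda_1\le\lambda_2\le\cdots$ (so $\lambda_1>0$). For real $q\ge 0$ let $\mathbb H_q=\{g\in L^2(\Omega):\|g\|_{\mathbb H_q}^2=\sum_n\lambda_n^{2q}\langle g,\varphi_n\rangle^2<\infty\}$. Let $\tau>0$ and let $\psi\in C([0,\tau])$ satisfy the following: there are $\tau_0\in[0,\tau)$ and $\kappa_1>0$ with $|\psi|\ge\kappa_1$ on $[\tau_0,\tau]$, and either (a) $\psi$ does not change sign on $[0,\tau]$ (that is, $\psi\ge0$ throughout or $\psi\le0$ throughout), or (b) $\psi$ changes sign on $[0,\tau]$, is differentiable on $[0,\tau]$ with $\psi'$ bounded, and $|\psi(t)|\le\frac{(\tau-\tau_0)^2\kappa_1}{4\tau\tau_0}$ for every $t\in[0,\tau]$ with $\psi(t)\psi(\tau)\le0$. Put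 $\mu_n=\int_0^\tau e^{-\lambda_n(\tau-s)}(\tau-s)\psi(s)\,ds$. For $b\ge2$ and $\alpha>0$ let $T_\alpha$ be the operator in $L^2(\Omega)$ with domain $\mathbb H_{b-2}$ given by $$T_\alpha g=\sum_{n}(1+\alpha\lambda_n^b)\,\mu_n\,\langle g,\varphi_n\rangle\,\varphi_n .$$ Then there is a constant $C>0$ with $|\mu_n|\ge C/\lambda_n^2$ for all $n$, and for all $b\ge 2$ and $\alpha>0$ the operator $T_\alpha$ is a bijection from $\mathbb H_{b-2}$ onto $L^2(\Omega)$. Fix any such $C$. Let $b\ge2$, let $p,\varrho,\delta,\alpha>0$, let $f\in L^2(\Omega)$ satisfy $\|f\|_{\mathbb H_p}\le\varrho$, let $u\in C([0,\tau];L^2(\Omega))$ be the weak solution of $$u_{tt}-2\Delta u_t+\Delta^2u=\psi(t)f(x)\ \text{in }\Omega\times(0,\tau),\qquad u=0=\Delta u\ \text{on }\partial\Omega\times(0,\tau),\qquad u(\cdot,0)=0=u_t(\cdot,0)\ \text{in }\Omega$$ (the equation being tested with all functions $w$ in the domain of the square of the Dirichlet Laplacian), let $h=u(\cdot,\tau)$,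 let $h^\delta\in L^2(\Omega)$ satisfy $\|h-h^\delta\|_{L^2(\Omega)}\le\delta$, and let $f_\alpha^\delta=T_\alpha^{-1}h^\delta$. Let $0<c_1\le c_2$. (i) If $0<p<b$ and $c_1(\delta/\varrho)^{\frac b{p+2}}\le\alpha\le c_2(\delta/\varrho)^{\frac b{p+2}}$, then $$\|f-f_\alpha^\delta\|_{L^2(\Omega)}\le C_1\,\varrho^{\frac2{p+2}}\,\delta^{\frac p{p+2}},$$ where $C_1>0$ depends only on $C,p,b$ and on $c_1,c_2$. (ii) If $p\ge b$ and $c_1(\delta/\varrho)^{\frac b{b+2}}\le\alpha\le c_2(\delta/\varrho)^{\frac b{b+2}}$, then $$\|f-f_\alpha^\delta\|_{L^2(\Omega)}\le C_2\,\varrho^{\frac2{b+2}}\,\delta^{\frac b{b+2}},$$ where $C_2>0$ depends only on $C,\lambda_1,p,b$ and on $c_1,c_2$. -/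

import Mathlib

open MeasureTheory Set Filter Topology
open scoped RealInnerProductSpace ContDiff NNReal

noncomputable section

namespace Biparabolic

/-- `ℝ^d` with its Euclidean norm. -/
abbrev Space (d : ℕ) : Type := EuclideanSpace ℝ (Fin d)

/-- The real Hilbert space `L²(Ω)`. -/
abbrev L2 {d : ℕ} (Ω : Set (Space d)) : Type := Lp ℝ 2 (volume.restrict Ω)

/-- A bounded domain with Lipschitz boundary: near each boundary point, in a suitable direction `e`,
the set `Ω` is the strict epigraph of a Lipschitz function of the component orthogonal to `e`. -/
structure IsBoundedLipschitzDomain {d : ℕ} (Ω : Set (Space d)) : Prop where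
  isOpen : IsOpen Ω
  isConnected : IsConnected Ω
  isBounded : Bornology.IsBounded Ω
  lipschitz_boundary : ∀ x ∈ frontier Ω, ∃ r > 0, ∃ e : Space d, ‖e‖ = 1 ∧
    ∃ (K : ℝ≥0) (γ : Space d → ℝ), LipschitzWith K γ ∧
      ∀ y ∈ Metric.ball x r, y ∈ Ω ↔ γ (y - ⟪e, y⟫ • e) < ⟪e, y⟫

/-- Test functions: the elements of `C_c^∞(Ω)`. -/
def IsTestFunction {d : ℕ} (Ω : Set (Space d)) (v : Space d → ℝ) : Prop :=
  ContDiff ℝ ∞ v ∧ HasCompactSupport v ∧ tsupport v ⊆ Ω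

/-- `w ∈ H¹₀(Ω)` with weak gradient `G`: the pair `(w, G)` is an `L²`-limit of pairs `(v, ∇ v)` with
`v ∈ C_c^∞(Ω)`, that is, `w` is in the closure of `C_c^∞(Ω)` for the `H¹`-norm. -/
def MemH10WithGradient {d : ℕ} (Ω : Set (Space d)) (w : L2 Ω)
    (G : Lp (Space d) 2 (volume.restrict Ω)) : Prop :=
  ∃ v : ℕ → Space d → ℝ, (∀ k, IsTestFunction Ω (v k)) ∧
    Tendsto (fun k => eLpNorm (fun x => v k x - w x) 2 (volume.restrict Ω)) atTop (𝓝 0) ∧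
    Tendsto (fun k => eLpNorm (fun x => gradient (v k) x - G x) 2 (volume.restrict Ω)) atTop (𝓝 0)

/-- `w` is in the domain of the Dirichlet Laplacian of `Ω` and `-Δ w = g`: one has `w ∈ H¹₀(Ω)` and
`∫ ∇w · ∇v = ∫ g v` for all test functions `v`. -/
def NegDirichletLaplacian {d : ℕ} (Ω : Set (Space d)) (w g : L2 Ω) : Prop :=
  ∃ G : Lp (Space d) 2 (volume.restrict Ω), MemH10WithGradient Ω w G ∧
    ∀ v : Space d → ℝ, IsTestFunction Ω v →
      ∫ x in Ω, ⟪G x, gradient v x⟫ = ∫ x in Ω, g x * v x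

/-- An orthonormal basis of `L²(Ω)` made of eigenfunctions of the Dirichlet Laplacian, listed with
nondecreasing eigenvalues; `lam 0` is the lowest eigenvalue, written `λ₁` in the usual numbering. -/
structure IsDirichletEigensystem {d : ℕ} (Ω : Set (Space d)) (lam : ℕ → ℝ)
    (φ : HilbertBasis ℕ ℝ (L2 Ω)) : Prop where
  mono : Monotone lam
  eigen : ∀ n, NegDirichletLaplacian Ω (φ n) (lam n • φ n)

/-- The continuous function `ψ` does not change sign on `[0, τ]`. -/
def HasConstantSign (τ : ℝ) (ψ : ℝ → ℝ) : Prop :=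
  (∀ t ∈ Icc 0 τ, 0 ≤ ψ t) ∨ (∀ t ∈ Icc 0 τ, ψ t ≤ 0)

/-- The standing assumption on the time-dependent factor `ψ` of the source. -/
def TimeFactorAssumption (τ : ℝ) (ψ : ℝ → ℝ) : Prop :=
  ∃ τ₀ ∈ Ico 0 τ, ∃ κ₁ > 0, (∀ t ∈ Icc τ₀ τ, κ₁ ≤ |ψ t|) ∧
    (HasConstantSign τ ψ ∨
      (¬ HasConstantSign τ ψ ∧ DifferentiableOn ℝ ψ (Icc 0 τ) ∧
        (∃ κ₂ > 0, ∀ t ∈ Icc 0 τ, |derivWithin ψ (Icc 0 τ) t| ≤ κ₂) ∧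
        ∀ t ∈ Icc 0 τ, ψ t * ψ τ ≤ 0 → |ψ t| ≤ (τ - τ₀) ^ 2 * κ₁ / (4 * τ * τ₀)))

/-- Weak solutions `u ∈ C([0, τ]; L²(Ω))` of the forward problem
`u_tt - 2 Δ u_t + Δ² u = ψ(t) f(x)` in `Ω × (0, τ)`, `u = 0 = Δ u` on `∂Ω × (0, τ)`,
`u(0) = 0 = u_t(0)`. The equation is tested with the functions `w` in the domain of the square of
the Dirichlet Laplacian; here `w₁ = -Δ w` and `w₂ = Δ² w`, and `y' = d/dt ⟨u, w⟩`,
`y'' = d²/dt² ⟨u, w⟩`, `z' = d/dt ⟨u, -Δ w⟩`. -/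
structure IsWeakSolution {d : ℕ} (Ω : Set (Space d)) (τ : ℝ) (ψ : ℝ → ℝ) (f : L2 Ω)
    (u : ℝ → L2 Ω) : Prop where
  continuousOn : ContinuousOn u (Icc 0 τ)
  initial : u 0 = 0
  equation : ∀ w w₁ w₂ : L2 Ω, NegDirichletLaplacian Ω w w₁ → NegDirichletLaplacian Ω w₁ w₂ →
    ∃ y' y'' z' : ℝ → ℝ, y' 0 = 0 ∧ ∀ t ∈ Icc 0 τ,
      HasDerivWithinAt (fun s => ⟪u s, w⟫) (y' t) (Icc 0 τ) t ∧
      HasDerivWithinAt y' (y'' t) (Icc 0 τ) t ∧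
      HasDerivWithinAt (fun s => ⟪u s, w₁⟫) (z' t) (Icc 0 τ) t ∧
      y'' t + 2 * z' t + ⟪u t, w₂⟫ = ψ t * ⟪f, w⟫

/-- `μ_n = ∫_0^τ e^{-λ_n (τ - s)} (τ - s) ψ(s) ds`. -/
def mu (τ : ℝ) (ψ : ℝ → ℝ) (lam : ℕ → ℝ) (n : ℕ) : ℝ :=
  ∫ s in (0 : ℝ)..τ, Real.exp (-(lam n) * (τ - s)) * (τ - s) * ψ s

/-- The space `ℍ_p = {g ∈ L²(Ω) : ∑ λ_n^{2p} |⟨g, φ_n⟩|² < ∞}`. -/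
def scaleSpace {d : ℕ} {Ω : Set (Space d)} (lam : ℕ → ℝ) (φ : HilbertBasis ℕ ℝ (L2 Ω))
    (p : ℝ) : Set (L2 Ω) :=
  {g | Summable fun n => lam n ^ (2 * p) * ⟪g, φ n⟫ ^ 2}

/-- The source set `S_{ϱ,p} = {g ∈ ℍ_p : ‖g‖_{ℍ_p} ≤ ϱ}`. -/
def sourceSet {d : ℕ} {Ω : Set (Space d)} (lam : ℕ → ℝ) (φ : HilbertBasis ℕ ℝ (L2 Ω))
    (ϱ p : ℝ) : Set (L2 Ω) :=
  {g | g ∈ scaleSpace lam φ p ∧ ∑' n, lam n ^ (2 * p) * ⟪g, φ n⟫ ^ 2 ≤ ϱ ^ 2}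

/-- The operator `T_α g = ∑ (1 + α λ_n^b) μ_n ⟨g, φ_n⟩ φ_n`, with domain `ℍ_{b-2}`; the series
converges in `L²(Ω)` for `g` in this domain. Outside of it the value is not used. -/
def qrmOperator {d : ℕ} {Ω : Set (Space d)} (lam : ℕ → ℝ) (φ : HilbertBasis ℕ ℝ (L2 Ω))
    (τ : ℝ) (ψ : ℝ → ℝ) (b α : ℝ) (g : L2 Ω) : L2 Ω :=
  ∑' n, ((1 + α * lam n ^ b) * mu τ ψ lam n * ⟪g, φ n⟫) • φ n

/-- The quasi-reversibility approximation `T_α⁻¹ h`, the element of `ℍ_{b-2}` that `T_α` maps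
to `h`. -/
def qrmApprox {d : ℕ} {Ω : Set (Space d)} (lam : ℕ → ℝ) (φ : HilbertBasis ℕ ℝ (L2 Ω))
    (τ : ℝ) (ψ : ℝ → ℝ) (b α : ℝ) (h : L2 Ω) : L2 Ω :=
  Function.invFunOn (qrmOperator lam φ τ ψ b α) (scaleSpace lam φ (b - 2)) h

/-- `C` is a constant with `|μ_n| ≥ C / λ_n²` for all `n`. -/
def IsLowerConstant (τ : ℝ) (ψ : ℝ → ℝ) (lam : ℕ → ℝ) (C : ℝ) : Prop :=
  0 < C ∧ ∀ n, C / lam n ^ 2 ≤ |mu τ ψ lam n|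

end Biparabolic

end

/-! Everything is diagonal in the eigenbasis. Tested with `φ n`, the equation becomes `y'' + 2 λ y'
+ λ² y = ψ c` with zero initial data, so the double root `-λ` gives the final coefficients `⟪h, φ n⟫
= μ_n ⟪f, φ n⟫` (`IsWeakSolution.inner_final_eq`). Positivity of the eigenvalues follows from the
Poincaré inequality. The kernel has mass of order `λ⁻²` concentrated near `s = τ`, where `|ψ| ≥ κ₁`;
the part of `ψ` of the opposite sign acts only before `τ₀`, where the kernel is at most `τ
e^{-λ(τ-τ₀)}`. Hence `|μ_n|` lies between multiples of `λ_n⁻²` (`exists_isLowerConstant`,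
`exists_abs_mu_le`), the symbol of `T_α` is comparable to `λ_n^(b-2)` for fixed `α`, and `T_α` is
bijective. The error is `f - T_α⁻¹ h` plus `T_α⁻¹ (h - h^δ)`. The first has coefficients `α λ^b / (1
+ α λ^b) ⟪f, φ n⟫`, controlled by the source condition; the second is at most `α^(-2/b) δ / C`. The
choice of `α` balances the two (`norm_sub_qrmApprox_le`). -/

namespace Biparabolic

/-! ### Parseval and Riesz–Fischer in coordinates -/

section HilbertBasis

variable {H : Type*} [NormedAddCommGroup H] [InnerProductSpace ℝ H] (φ : HilbertBasis ℕ ℝ H)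

theorem hasSum_inner_sq (g : H) : HasSum (fun n => ⟪g, φ n⟫ ^ 2) (‖g‖ ^ 2) := by
  have h := φ.hasSum_inner_mul_inner g g
  rw [real_inner_self_eq_norm_sq] at h
  refine h.congr_fun fun n => ?_
  rw [real_inner_comm g (φ n), sq]

theorem exists_inner_eq (c : ℕ → ℝ) (hc : Summable fun n => c n ^ 2) :
    ∃ g : H, ∀ n, ⟪g, φ n⟫ = c n := by
  have hmem : Memℓp c 2 := memℓp_gen (by simpa using hc)
  refine ⟨φ.repr.symm ⟨c, hmem⟩, fun n => ?_⟩
  rw [real_inner_comm, ← φ.repr_apply_apply, LinearIsometryEquiv.apply_symm_apply]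

theorem eq_of_inner_eq {g k : H} (h : ∀ n, ⟪g, φ n⟫ = ⟪k, φ n⟫) : g = k := by
  apply φ.repr.injective
  ext n
  rw [φ.repr_apply_apply, φ.repr_apply_apply, real_inner_comm, h, real_inner_comm]

theorem tsum_smul_eq_of_inner_eq {k : H} {c : ℕ → ℝ} (h : ∀ n, ⟪k, φ n⟫ = c n) :
    ∑' n, c n • φ n = k := by
  refine HasSum.tsum_eq ((φ.hasSum_repr k).congr_fun fun n => ?_)
  rw [φ.repr_apply_apply, real_inner_comm, h]

theorem norm_le_of_inner_sq_le {e : H} {A R : ℝ} (hA : 0 ≤ A) (hR : 0 ≤ R) {a : ℕ → ℝ}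
    (ha : Summable a) (haR : ∑' n, a n ≤ R ^ 2) (h : ∀ n, ⟪e, φ n⟫ ^ 2 ≤ A ^ 2 * a n) :
    ‖e‖ ≤ A * R := by
  refine (sq_le_sq₀ (norm_nonneg e) (by positivity)).mp ?_
  calc ‖e‖ ^ 2 ≤ A ^ 2 * ∑' n, a n := hasSum_le h (hasSum_inner_sq φ e) (ha.hasSum.mul_left _)
    _ ≤ A ^ 2 * R ^ 2 := by gcongr
    _ = (A * R) ^ 2 := by ring

theorem norm_le_of_abs_inner_le {e g : H} {A : ℝ} (hA : 0 ≤ A)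
    (h : ∀ n, |⟪e, φ n⟫| ≤ A * |⟪g, φ n⟫|) : ‖e‖ ≤ A * ‖g‖ := by
  refine norm_le_of_inner_sq_le φ hA (norm_nonneg g) (hasSum_inner_sq φ g).summable
    (hasSum_inner_sq φ g).tsum_eq.le fun n => ?_
  calc ⟪e, φ n⟫ ^ 2 = |⟪e, φ n⟫| ^ 2 := (sq_abs _).symm
    _ ≤ (A * |⟪g, φ n⟫|) ^ 2 := by gcongr; exact h n
    _ = A ^ 2 * ⟪g, φ n⟫ ^ 2 := by rw [mul_pow, sq_abs]

end HilbertBasis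

/-! ### The kernel, bounds for `μ_n`, and the scalar ODE -/

section Kernel

variable {τ : ℝ} {ψ : ℝ → ℝ}

theorem continuous_kernel (l τ : ℝ) : Continuous fun s => Real.exp (-l * (τ - s)) * (τ - s) := by
  fun_prop

theorem intervalIntegrable_kernel_mul (hψ : ContinuousOn ψ (Icc 0 τ)) (l : ℝ) {a b : ℝ}
    (ha : a ∈ Icc 0 τ) (hb : b ∈ Icc 0 τ) :
    IntervalIntegrable (fun s => Real.exp (-l * (τ - s)) * (τ - s) * ψ s) volume a b := by
  refine ContinuousOn.intervalIntegrable ?_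
  exact (continuous_kernel l τ).continuousOn.mul
    (hψ.mono ((convex_Icc 0 τ).ordConnected.uIcc_subset ha hb))

theorem integral_kernel_le (τ : ℝ) {l : ℝ} (hτ : 0 ≤ τ) (hl : 0 < l) :
    ∫ s in (0 : ℝ)..τ, Real.exp (-l * (τ - s)) * (τ - s) ≤ 1 / l ^ 2 := by
  have hd : ∀ s ∈ uIcc 0 τ, HasDerivAt
      (fun s => Real.exp (-l * (τ - s)) * ((τ - s) / l + 1 / l ^ 2))
      (Real.exp (-l * (τ - s)) * (τ - s)) s := by
    intro s _
    have h1 : HasDerivAt (fun s => τ - s) (-1) s := (hasDerivAt_id s).const_sub τ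
    have h2 := (h1.const_mul (-l)).exp.mul ((h1.div_const l).add_const (1 / l ^ 2))
    refine h2.congr_deriv ?_
    field_simp
    ring
  rw [intervalIntegral.integral_eq_sub_of_hasDerivAt hd
    ((continuous_kernel l τ).intervalIntegrable 0 τ)]
  have : 0 ≤ Real.exp (-l * (τ - 0)) * ((τ - 0) / l + 1 / l ^ 2) := by
    rw [sub_zero]; positivity
  simp only [sub_self, mul_zero, Real.exp_zero, zero_div, zero_add, one_mul]
  linarith

/-- Only the last window of length `S` is kept, and there the exponential is replaced by its
minimum. The length `S` stays free because two different choices are needed in the lower bound for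
`μ_n`. -/
theorem le_integral_kernel {l τ₀ S : ℝ} (hl : 0 ≤ l) (hS : 0 ≤ S) (hST : S ≤ τ - τ₀) :
    Real.exp (-l * S) * (S ^ 2 / 2) ≤ ∫ s in τ₀..τ, Real.exp (-l * (τ - s)) * (τ - s) := by
  have hi : IntervalIntegrable (fun s => Real.exp (-l * (τ - s)) * (τ - s)) volume τ₀ τ :=
    (continuous_kernel l τ).intervalIntegrable _ _
  calc Real.exp (-l * S) * (S ^ 2 / 2)
      = ∫ s in (τ - S)..τ, Real.exp (-l * S) * (τ - s) := by
        rw [intervalIntegral.integral_const_mul, intervalIntegral.integral_sub (by simp)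
          (by simp), integral_id, intervalIntegral.integral_const, smul_eq_mul]
        ring
    _ ≤ ∫ s in (τ - S)..τ, Real.exp (-l * (τ - s)) * (τ - s) := by
        refine intervalIntegral.integral_mono_on (by linarith)
          (Continuous.intervalIntegrable (by fun_prop) _ _)
          ((continuous_kernel l τ).intervalIntegrable _ _) fun s hs => ?_
        have h1 : τ - s ≤ S := by linarith [hs.1]
        have h2 : 0 ≤ τ - s := by linarith [hs.2]
        have h3 : -l * S ≤ -l * (τ - s) := by nlinarith
        gcongr
    _ ≤ _ := by
        refine intervalIntegral.integral_mono_interval (by linarith) (by linarith) le_rfl ?_ hi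
        filter_upwards [ae_restrict_mem measurableSet_Ioc] with s hs
        exact mul_nonneg (Real.exp_pos _).le (by linarith [hs.2])

theorem exists_abs_mu_le (hτ : 0 < τ) (hψ : ContinuousOn ψ (Icc 0 τ)) :
    ∃ K > 0, ∀ (lam : ℕ → ℝ) n, 0 < lam n → |mu τ ψ lam n| ≤ K / lam n ^ 2 := by
  obtain ⟨K, hK⟩ := isCompact_Icc.exists_bound_of_continuousOn hψ
  refine ⟨max K 1, by positivity, fun lam n hl => ?_⟩
  have h0 : (0 : ℝ) ∈ Icc 0 τ := ⟨le_rfl, hτ.le⟩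
  have h1 : τ ∈ Icc 0 τ := ⟨hτ.le, le_rfl⟩
  calc |mu τ ψ lam n|
      ≤ ∫ s in (0 : ℝ)..τ, max K 1 * (Real.exp (-(lam n) * (τ - s)) * (τ - s)) := by
        unfold mu
        rw [← Real.norm_eq_abs]
        refine intervalIntegral.norm_integral_le_of_norm_le hτ.le ?_
          (((continuous_kernel _ τ).const_mul _).intervalIntegrable _ _)
        filter_upwards with s hs
        have hs' : s ∈ Icc 0 τ := ⟨hs.1.le, hs.2⟩
        have h2 : 0 ≤ Real.exp (-(lam n) * (τ - s)) * (τ - s) :=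
          mul_nonneg (Real.exp_pos _).le (by linarith [hs.2])
        rw [norm_mul, Real.norm_of_nonneg h2, mul_comm]
        gcongr
        exact (hK s hs').trans (le_max_left _ _)
    _ = max K 1 * ∫ s in (0 : ℝ)..τ, Real.exp (-(lam n) * (τ - s)) * (τ - s) :=
        intervalIntegral.integral_const_mul _ _
    _ ≤ max K 1 * (1 / lam n ^ 2) := by
        gcongr
        exact integral_kernel_le τ hτ.le hl
    _ = max K 1 / lam n ^ 2 := by ring

/-- Up to a sign, `ψ` is bounded below by `κ` near the final time, and its part of the opposite
sign is too small to compensate for this. -/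
theorem TimeFactorAssumption.exists_sign (hτ : 0 < τ) (hψ : ContinuousOn ψ (Icc 0 τ))
    (h : TimeFactorAssumption τ ψ) :
    ∃ τ₀ ∈ Ico 0 τ, ∃ κ > 0, ∃ M ≥ 0, M * τ * τ₀ ≤ (τ - τ₀) ^ 2 * κ / 4 ∧
      ∃ σ : ℝ, |σ| = 1 ∧ (∀ t ∈ Icc τ₀ τ, κ ≤ σ * ψ t) ∧ ∀ t ∈ Icc 0 τ₀, -M ≤ σ * ψ t := by
  obtain ⟨τ₀, hτ₀, κ, hκ, hlow, hcase⟩ := h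
  have hττ : τ ∈ Icc τ₀ τ := ⟨hτ₀.2.le, le_rfl⟩
  have hsub : Icc τ₀ τ ⊆ Icc 0 τ := Icc_subset_Icc_left hτ₀.1
  -- `σ` is the sign of `ψ τ`. As `ψ` has no zero on `[τ₀, τ]`, the intermediate value theorem
  -- propagates this sign to the whole interval.
  obtain ⟨σ, hσ, hστ⟩ : ∃ σ : ℝ, |σ| = 1 ∧ σ * ψ τ = |ψ τ| := by
    rcases le_total 0 (ψ τ) with h | h
    · exact ⟨1, by simp, by rw [abs_of_nonneg h, one_mul]⟩
    · exact ⟨-1, by simp, by rw [abs_of_nonpos h, neg_one_mul]⟩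
  have hpos : 0 < σ * ψ τ := by rw [hστ]; exact hκ.trans_le (hlow τ hττ)
  have habs : ∀ t, |σ * ψ t| = |ψ t| := fun t => by rw [abs_mul, hσ, one_mul]
  have hend : ∀ t ∈ Icc τ₀ τ, κ ≤ σ * ψ t := by
    intro t ht
    rcases le_total 0 (σ * ψ t) with h | h
    · rw [← abs_of_nonneg h, habs]; exact hlow t ht
    · exfalso
      have hc : ContinuousOn (fun t => σ * ψ t) (Icc t τ) :=
        (hψ.mono ((Icc_subset_Icc_left ht.1).trans hsub)).const_smul σ
      obtain ⟨s, hs, hs0⟩ := intermediate_value_Icc ht.2 hc ⟨h, hpos.le⟩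
      have h1 := hlow s ⟨ht.1.trans hs.1, hs.2⟩
      rw [← habs, show σ * ψ s = 0 from hs0, abs_zero] at h1
      linarith
  refine ⟨τ₀, hτ₀, κ, hκ, ?_⟩
  rcases hcase with hsign | ⟨_, _, _, hbd⟩
  · refine ⟨0, le_rfl, by rw [zero_mul, zero_mul]; positivity, σ, hσ, hend, fun t ht => ?_⟩
    have htI : t ∈ Icc 0 τ := ⟨ht.1, ht.2.trans hτ₀.2.le⟩
    have hτI : τ ∈ Icc 0 τ := ⟨hτ.le, le_rfl⟩
    rw [neg_zero]
    rcases hsign with hs | hs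
    · have : 0 ≤ σ := by
        by_contra hneg
        nlinarith [hs τ hτI]
      exact mul_nonneg this (hs t htI)
    · have : σ ≤ 0 := by
        by_contra hneg
        nlinarith [hs τ hτI]
      exact mul_nonneg_of_nonpos_of_nonpos this (hs t htI)
  · have hM : 0 ≤ (τ - τ₀) ^ 2 * κ / (4 * τ * τ₀) :=
      div_nonneg (by positivity) (mul_nonneg (by positivity) hτ₀.1)
    refine ⟨_, hM, ?_, σ, hσ, hend, fun t ht => ?_⟩
    -- For `τ₀ = 0` the quotient is division by zero, hence `0`; the factor `τ₀` makes the left side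
    -- vanish anyway.
    · rcases hτ₀.1.eq_or_lt with h0 | h0
      · rw [← h0, mul_zero]; positivity
      · refine le_of_eq ?_
        field_simp
    · have htI : t ∈ Icc 0 τ := ⟨ht.1, ht.2.trans hτ₀.2.le⟩
      rcases le_total 0 (σ * ψ t) with h | h
      · linarith
      · have hσ2 : σ * σ = 1 := by rw [← abs_mul_abs_self, hσ, one_mul]
        have h2 : ψ t * ψ τ ≤ 0 := by
          calc ψ t * ψ τ = (σ * ψ t) * (σ * ψ τ) := by linear_combination (-ψ t * ψ τ) * hσ2
            _ ≤ 0 := mul_nonpos_of_nonpos_of_nonneg h hpos.le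
        have h3 := hbd t htI h2
        rw [← habs] at h3
        exact (abs_le.mp h3).1

/-- With `J` the kernel mass on `[τ₀, τ]`, that interval contributes at least `κ J` to `σ μ_n`, and
`[0, τ₀]` loses at most `e^{-lT} T² κ / 4`. Half of `κ J` pays for the loss, and the other half is
at least a multiple of `l⁻²`. -/
theorem TimeFactorAssumption.exists_isLowerConstant (hτ : 0 < τ) (hψ : ContinuousOn ψ (Icc 0 τ))
    (h : TimeFactorAssumption τ ψ) {lam : ℕ → ℝ} {l₀ : ℝ} (hl₀ : 0 < l₀)
    (hlam : ∀ n, l₀ ≤ lam n) : ∃ C, IsLowerConstant τ ψ lam C := by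
  obtain ⟨τ₀, ⟨hτ₀, hτ₀τ⟩, κ, hκ, M, hM, hMle, σ, hσ, hend, hstart⟩ := h.exists_sign hτ hψ
  set T := τ - τ₀ with hT
  have hTpos : 0 < T := sub_pos.mpr hτ₀τ
  refine ⟨κ / 4 * (Real.exp (-l₀ * T) * (T * l₀) ^ 2), by positivity, fun n => ?_⟩
  set l := lam n with hl
  have hl0 : l₀ ≤ l := hlam n
  have hlpos : 0 < l := hl₀.trans_le hl0
  have m0 : (0 : ℝ) ∈ Icc 0 τ := ⟨le_rfl, hτ.le⟩
  have m1 : τ₀ ∈ Icc 0 τ := ⟨hτ₀, hτ₀τ.le⟩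
  have m2 : τ ∈ Icc 0 τ := ⟨hτ.le, le_rfl⟩
  have hψσ : ContinuousOn (fun s => σ * ψ s) (Icc 0 τ) := hψ.const_smul σ
  set J := ∫ s in τ₀..τ, Real.exp (-l * (τ - s)) * (τ - s) with hJ
  have hsplit : σ * mu τ ψ lam n =
      (∫ s in (0 : ℝ)..τ₀, Real.exp (-l * (τ - s)) * (τ - s) * (σ * ψ s)) +
        ∫ s in τ₀..τ, Real.exp (-l * (τ - s)) * (τ - s) * (σ * ψ s) := by
    rw [intervalIntegral.integral_add_adjacent_intervals
      (intervalIntegrable_kernel_mul hψσ l m0 m1) (intervalIntegrable_kernel_mul hψσ l m1 m2),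
      mu, ← intervalIntegral.integral_const_mul]
    congr 1
    ext s
    ring
  have hfirst : -(Real.exp (-l * T) * (T ^ 2 * κ / 4)) ≤
      ∫ s in (0 : ℝ)..τ₀, Real.exp (-l * (τ - s)) * (τ - s) * (σ * ψ s) := by
    calc -(Real.exp (-l * T) * (T ^ 2 * κ / 4))
        ≤ -(Real.exp (-l * T) * (M * τ * τ₀)) := by gcongr
      _ = ∫ _s in (0 : ℝ)..τ₀, -(Real.exp (-l * T) * τ * M) := by
          rw [intervalIntegral.integral_const, smul_eq_mul]
          ring
      _ ≤ _ := by
          refine intervalIntegral.integral_mono_on hτ₀ (by simp)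
            (intervalIntegrable_kernel_mul hψσ l m0 m1) fun s hs => ?_
          have h1 : 0 ≤ τ - s := by linarith [hs.2]
          have h2 : -l * (τ - s) ≤ -l * T := by
            rw [hT]; nlinarith [hs.2]
          have h3 : Real.exp (-l * (τ - s)) * (τ - s) ≤ Real.exp (-l * T) * τ := by
            gcongr
            linarith [hs.1]
          calc -(Real.exp (-l * T) * τ * M)
              ≤ -(Real.exp (-l * (τ - s)) * (τ - s) * M) := by gcongr
            _ = Real.exp (-l * (τ - s)) * (τ - s) * (-M) := by ring
            _ ≤ _ := by
              gcongr
              exact hstart s hs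
  have hsecond : κ * J ≤ ∫ s in τ₀..τ, Real.exp (-l * (τ - s)) * (τ - s) * (σ * ψ s) := by
    rw [hJ, ← intervalIntegral.integral_const_mul]
    refine intervalIntegral.integral_mono_on hτ₀τ.le
      (((continuous_kernel l τ).const_mul κ).intervalIntegrable _ _)
      (intervalIntegrable_kernel_mul hψσ l m1 m2) fun s hs => ?_
    have h1 : 0 ≤ τ - s := by linarith [hs.2]
    rw [mul_comm κ]
    gcongr
    exact hend s hs
  have hJ1 : Real.exp (-l * T) * (T ^ 2 / 2) ≤ J := le_integral_kernel hlpos.le hTpos.le le_rfl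
  -- The window `S = T l₀ / l` makes the exponential independent of `l` and leaves the factor `l⁻²`;
  -- `l₀ ≤ l` keeps it inside `[τ₀, τ]`.
  have hJ2 : Real.exp (-l₀ * T) * ((T * l₀ / l) ^ 2 / 2) ≤ J := by
    have h1 : T * l₀ / l ≤ T := by
      rw [div_le_iff₀ hlpos]
      gcongr
    have h2 := le_integral_kernel (τ := τ) (τ₀ := τ₀) hlpos.le (S := T * l₀ / l)
      (by positivity) h1
    have h3 : -l * (T * l₀ / l) = -l₀ * T := by field_simp
    rwa [h3] at h2
  have hmu : |mu τ ψ lam n| = |σ * mu τ ψ lam n| := by rw [abs_mul, hσ, one_mul]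
  rw [hmu]
  refine le_trans ?_ (le_abs_self _)
  have h4 : κ / 4 * (Real.exp (-l₀ * T) * (T * l₀) ^ 2) / l ^ 2 =
      κ / 2 * (Real.exp (-l₀ * T) * ((T * l₀ / l) ^ 2 / 2)) := by
    field_simp
    ring
  rw [h4, hsplit]
  nlinarith [mul_le_mul_of_nonneg_left hJ1 (half_pos hκ).le,
    mul_le_mul_of_nonneg_left hJ2 (half_pos hκ).le]

theorem eq_integral_kernel_mul_of_hasDerivWithinAt (hτ : 0 < τ) (hψ : ContinuousOn ψ (Icc 0 τ))
    {l c : ℝ} {y y' y'' : ℝ → ℝ} (hy0 : y 0 = 0) (hy'0 : y' 0 = 0)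
    (hy : ∀ t ∈ Icc 0 τ, HasDerivWithinAt y (y' t) (Icc 0 τ) t)
    (hy' : ∀ t ∈ Icc 0 τ, HasDerivWithinAt y' (y'' t) (Icc 0 τ) t)
    (heq : ∀ t ∈ Icc 0 τ, y'' t + 2 * (l * y' t) + l ^ 2 * y t = ψ t * c) :
    y τ = (∫ s in (0 : ℝ)..τ, Real.exp (-l * (τ - s)) * (τ - s) * ψ s) * c := by
  -- Variation of constants for the double root `-l`: this function equals `y τ` at `s = τ`,
  -- vanishes at `s = 0`, and its derivative is the kernel times `y'' + 2 l y' + l² y`.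
  have hd : ∀ t ∈ Icc 0 τ, HasDerivWithinAt
      (fun s => Real.exp (-l * (τ - s)) * ((τ - s) * (y' s + l * y s) + y s))
      (Real.exp (-l * (τ - t)) * (τ - t) * ψ t * c) (Icc 0 τ) t := by
    intro t ht
    have h1 : HasDerivWithinAt (fun s => τ - s) (-1) (Icc 0 τ) t :=
      ((hasDerivAt_id t).const_sub τ).hasDerivWithinAt
    have h2 := (h1.const_mul (-l)).exp.mul
      ((h1.mul ((hy' t ht).add ((hy t ht).const_mul l))).add (hy t ht))
    refine h2.congr_deriv ?_
    simp only [Pi.add_apply, Pi.mul_apply]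
    linear_combination Real.exp (-l * (τ - t)) * (τ - t) * heq t ht
  have hint : IntervalIntegrable (fun s => Real.exp (-l * (τ - s)) * (τ - s) * ψ s * c)
      volume 0 τ :=
    (intervalIntegrable_kernel_mul hψ l ⟨le_rfl, hτ.le⟩ ⟨hτ.le, le_rfl⟩).mul_const c
  have h := intervalIntegral.integral_eq_sub_of_hasDerivAt_of_le hτ.le
    (fun t ht => (hd t ht).continuousWithinAt)
    (fun t ht => (hd t (Ioo_subset_Icc_self ht)).hasDerivAt (Icc_mem_nhds ht.1 ht.2)) hint
  rw [intervalIntegral.integral_mul_const] at h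
  rw [h]
  simp [hy0, hy'0]

end Kernel

end Biparabolic

namespace Biparabolic

/-! ### Dirichlet Laplacian: Poincaré inequality, positive eigenvalues, Fourier coefficients -/

section Dirichlet

variable {d : ℕ} {Ω : Set (Space d)}

theorem inner_gradient_left {v : Space d → ℝ} (x e : Space d) :
    ⟪gradient v x, e⟫ = fderiv ℝ v x e := by
  rw [gradient, InnerProductSpace.toDual_symm_apply]

namespace IsTestFunction

variable {v : Space d → ℝ} {x : Space d}

theorem continuous_gradient (hv : IsTestFunction Ω v) : Continuous (gradient v) :=
  (InnerProductSpace.toDual ℝ (Space d)).symm.continuous.comp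
    (hv.1.continuous_fderiv (by simp))

theorem hasCompactSupport_gradient (hv : IsTestFunction Ω v) :
    HasCompactSupport (gradient v) :=
  (hv.2.1.fderiv ℝ).comp_left (map_zero _)

theorem memLp (hv : IsTestFunction Ω v) (μ : Measure (Space d)) [IsFiniteMeasureOnCompacts μ] :
    MemLp v 2 μ :=
  hv.1.continuous.memLp_of_hasCompactSupport hv.2.1

theorem memLp_gradient (hv : IsTestFunction Ω v) (μ : Measure (Space d))
    [IsFiniteMeasureOnCompacts μ] : MemLp (gradient v) 2 μ :=
  hv.continuous_gradient.memLp_of_hasCompactSupport hv.hasCompactSupport_gradient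

theorem gradient_eq_zero (hx : x ∉ tsupport v) : gradient v x = 0 := by
  have h1 : fderiv ℝ v x = 0 := by
    by_contra h
    exact hx (support_fderiv_subset ℝ h)
  rw [gradient, h1, map_zero]

theorem integrable_of_continuous (hv : IsTestFunction Ω v) {w : Space d → ℝ} (hw : Continuous w)
    (h : ∀ x, v x = 0 → gradient v x = 0 → w x = 0) : Integrable w := by
  refine hw.integrable_of_hasCompactSupport (hv.2.1.mono' fun x hx => ?_)
  by_contra hxv
  exact hx (h x (image_eq_zero_of_notMem_tsupport hxv) (gradient_eq_zero hxv))

/-- **Poincaré inequality** for test functions supported in a ball. -/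
theorem integral_sq_le (hv : IsTestFunction Ω v) (hd : 1 ≤ d) {R : ℝ}
    (hR : ∀ x ∈ Ω, ‖x‖ ≤ R) :
    ∫ x in Ω, v x ^ 2 ≤ 4 * R ^ 2 * ∫ x in Ω, ‖gradient v x‖ ^ 2 := by
  have hdiff : Differentiable ℝ v := hv.1.differentiable (by simp)
  have hvΩ : ∀ x, x ∉ Ω → v x = 0 := fun x hx =>
    image_eq_zero_of_notMem_tsupport fun h => hx (hv.2.2 h)
  have hgΩ : ∀ x, x ∉ Ω → gradient v x = 0 := fun x hx =>
    gradient_eq_zero fun h => hx (hv.2.2 h)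
  rw [setIntegral_eq_integral_of_forall_compl_eq_zero fun x hx => by rw [hvΩ x hx]; simp,
    setIntegral_eq_integral_of_forall_compl_eq_zero fun x hx => by rw [hgΩ x hx]; simp]
  let e : Space d := EuclideanSpace.single ⟨0, hd⟩ 1
  have he : ‖e‖ = 1 := by simp [e]
  have hsq : Differentiable ℝ fun x => v x ^ 2 := hdiff.pow 2
  have hcg : Continuous (gradient v) := hv.continuous_gradient
  have hcv : Continuous v := hv.1.continuous
  have hint : Integrable (fun x => v x ^ 2) :=
    hv.integrable_of_continuous (by fun_prop) fun x h0 _ => by simp [h0]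
  have hintg : Integrable (fun x => ‖gradient v x‖ ^ 2) :=
    hv.integrable_of_continuous (by fun_prop) fun x _ h0 => by simp [h0]
  have hfd : ∀ x, fderiv ℝ (fun x => v x ^ 2) x e = 2 * v x * ⟪gradient v x, e⟫ := fun x => by
    rw [inner_gradient_left, fderiv_fun_pow 2 (hdiff x)]
    simp
  have hfl : ∀ x, fderiv ℝ (fun x : Space d => ⟪e, x⟫) x e = 1 := fun x => by
    have h1 : HasFDerivAt (fun x : Space d => ⟪e, x⟫) (innerSL ℝ e) x :=
      (innerSL ℝ e).hasFDerivAt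
    rw [h1.fderiv, innerSL_apply_apply, real_inner_self_eq_norm_sq, he, one_pow]
  have hint' : Integrable (fun x : Space d => ⟪e, x⟫ * (2 * v x * ⟪gradient v x, e⟫)) :=
    hv.integrable_of_continuous (by fun_prop) fun x h0 _ => by simp [h0]
  -- Since `⟪e, x⟫` has derivative `1` along `e`, integration by parts turns `∫ v²` into `-∫ ⟪e, x⟫
  -- 2 v ∂_e v`. Young's inequality then leaves half of `∫ v²` to be absorbed on the left.
  have hparts := integral_mul_fderiv_eq_neg_fderiv_mul_of_integrable (μ := volume)
    (f := fun x : Space d => ⟪e, x⟫) (g := fun x => v x ^ 2) (v := e)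
    (by simp only [hfl, one_mul]; exact hint) (by simp only [hfd]; exact hint')
    (hv.integrable_of_continuous (by fun_prop) fun x h0 _ => by simp [h0])
    (fun x _ => (innerSL ℝ e).differentiableAt) (fun x _ => hsq x)
  simp only [hfl, hfd, one_mul] at hparts
  have hle : -∫ x : Space d, ⟪e, x⟫ * (2 * v x * ⟪gradient v x, e⟫) ≤
      ∫ x, (1 / 2 * v x ^ 2 + 2 * R ^ 2 * ‖gradient v x‖ ^ 2) := by
    rw [← integral_neg]
    refine integral_mono hint'.neg ((hint.const_mul _).add (hintg.const_mul _)) fun x => ?_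
    by_cases hx : x ∈ Ω
    · have h1 : |⟪e, x⟫| ≤ R := by
        simpa [he] using (abs_real_inner_le_norm e x).trans
          (by rw [he, one_mul]; exact hR x hx)
      have h2 : |⟪gradient v x, e⟫| ≤ ‖gradient v x‖ := by
        simpa [he] using abs_real_inner_le_norm (gradient v x) e
      have h3 : |⟪e, x⟫ * ⟪gradient v x, e⟫| ≤ R * ‖gradient v x‖ := by
        rw [abs_mul]
        exact mul_le_mul h1 h2 (abs_nonneg _) ((abs_nonneg _).trans h1)
      have h4 : (⟪e, x⟫ * ⟪gradient v x, e⟫) ^ 2 ≤ (R * ‖gradient v x‖) ^ 2 :=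
        sq_le_sq' (by linarith [abs_le.mp h3]) (abs_le.mp h3).2
      simp only
      nlinarith [sq_nonneg (v x + 2 * (⟪e, x⟫ * ⟪gradient v x, e⟫))]
    · simp [hvΩ x hx, hgΩ x hx]
  rw [integral_add (hint.const_mul _) (hintg.const_mul _), integral_const_mul,
    integral_const_mul] at hle
  rw [hparts, neg_neg] at hle
  linarith

end IsTestFunction

theorem inner_toLp_right {E : Type*} [NormedAddCommGroup E] [InnerProductSpace ℝ E]
    {α : Type*} [MeasurableSpace α] {μ : Measure α} (g : Lp E 2 μ) {v : α → E}
    (hv : MemLp v 2 μ) : ⟪g, hv.toLp v⟫ = ∫ x, ⟪g x, v x⟫ ∂μ := by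
  rw [L2.inner_def]
  refine integral_congr_ae ?_
  filter_upwards [hv.coeFn_toLp] with x hx
  rw [hx]

theorem norm_toLp_sq {E : Type*} [NormedAddCommGroup E] [InnerProductSpace ℝ E]
    {α : Type*} [MeasurableSpace α] {μ : Measure α} {v : α → E}
    (hv : MemLp v 2 μ) : ‖hv.toLp v‖ ^ 2 = ∫ x, ‖v x‖ ^ 2 ∂μ := by
  rw [← real_inner_self_eq_norm_sq, inner_toLp_right]
  refine integral_congr_ae ?_
  filter_upwards [hv.coeFn_toLp] with x hx
  rw [hx, real_inner_self_eq_norm_sq]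

theorem tendsto_toLp {E : Type*} [NormedAddCommGroup E] {α : Type*} [MeasurableSpace α]
    {μ : Measure α} {v : ℕ → α → E} (hv : ∀ k, MemLp (v k) 2 μ) {w : Lp E 2 μ}
    (h : Tendsto (fun k => eLpNorm (fun x => v k x - w x) 2 μ) atTop (𝓝 0)) :
    Tendsto (fun k => (hv k).toLp (v k)) atTop (𝓝 w) := by
  rw [Lp.tendsto_Lp_iff_tendsto_eLpNorm']
  refine h.congr fun k => eLpNorm_congr_ae ?_
  filter_upwards [(hv k).coeFn_toLp] with x hx
  rw [Pi.sub_apply, hx]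

/-- Testing with the approximating `v k` and passing to the limit amounts to testing with `w`
itself, so `‖G‖² = ⟪g, w⟫`; the Poincaré inequality survives the same limit. -/
theorem NegDirichletLaplacian.norm_sq_le {w g : L2 Ω} (h : NegDirichletLaplacian Ω w g)
    (hd : 1 ≤ d) {R : ℝ} (hR : ∀ x ∈ Ω, ‖x‖ ≤ R) :
    ‖w‖ ^ 2 ≤ 4 * R ^ 2 * ⟪g, w⟫ := by
  obtain ⟨G, ⟨v, hv, hvw, hvG⟩, hG⟩ := h
  have hV := tendsto_toLp (fun k => (hv k).memLp (volume.restrict Ω)) hvw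
  have hD := tendsto_toLp (fun k => (hv k).memLp_gradient (volume.restrict Ω)) hvG
  have heq : ⟪G, G⟫ = ⟪g, w⟫ := by
    refine tendsto_nhds_unique (tendsto_const_nhds.inner hD) ?_
    refine (tendsto_const_nhds.inner hV).congr fun k => ?_
    rw [inner_toLp_right, inner_toLp_right, hG _ (hv k)]
    refine integral_congr_ae (ae_of_all _ fun x => ?_)
    simp [mul_comm]
  rw [← heq, real_inner_self_eq_norm_sq]
  refine le_of_tendsto_of_tendsto' (hV.norm.pow 2) ((hD.norm.pow 2).const_mul _) fun k => ?_
  rw [norm_toLp_sq, norm_toLp_sq]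
  simpa using (hv k).integral_sq_le hd hR

/-- Applied to `φ n`, this supplies the second Laplacian, which makes eigenfunctions admissible in
the weak equation. -/
theorem NegDirichletLaplacian.const_smul {w g : L2 Ω} (h : NegDirichletLaplacian Ω w g) (c : ℝ) :
    NegDirichletLaplacian Ω (c • w) (c • g) := by
  obtain ⟨G, ⟨v, hv, hvw, hvG⟩, hG⟩ := h
  have key : ∀ {E : Type} [NormedAddCommGroup E] [NormedSpace ℝ E] (W : Lp E 2 (volume.restrict Ω))
      (f f' : ℕ → Space d → E), (∀ k x, f' k x = c • f k x) →
      Tendsto (fun k => eLpNorm (fun x => f k x - W x) 2 (volume.restrict Ω)) atTop (𝓝 0) →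
      Tendsto (fun k => eLpNorm (fun x => f' k x - (c • W : Lp E 2 (volume.restrict Ω)) x) 2
        (volume.restrict Ω)) atTop (𝓝 0) := by
    intro E _ _ W f f' hf ht
    have h1 : ∀ k, eLpNorm (fun x => f' k x - (c • W : Lp E 2 (volume.restrict Ω)) x) 2
        (volume.restrict Ω) = ‖c‖ₑ * eLpNorm (fun x => f k x - W x) 2 (volume.restrict Ω) := by
      intro k
      rw [← eLpNorm_const_smul]
      refine eLpNorm_congr_ae ?_
      filter_upwards [Lp.coeFn_smul c W] with x hx
      simp [hx, hf, smul_sub]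
    simp only [h1]
    simpa using ENNReal.Tendsto.const_mul ht (Or.inr enorm_ne_top)
  have hgrad : ∀ k x, gradient (fun y => c • v k y) x = c • gradient (v k) x := by
    intro k x
    have hdiff : DifferentiableAt ℝ (v k) x := (hv k).1.differentiable (by simp) x
    rw [gradient, fderiv_fun_const_smul hdiff, gradient]
    simp
  refine ⟨c • G, ⟨fun k x => c • v k x, fun k => ⟨(hv k).1.const_smul c,
    (hv k).2.1.comp_left (smul_zero c), ?_⟩, ?_, ?_⟩, fun u hu => ?_⟩
  · refine (closure_mono ?_).trans (hv k).2.2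
    exact Function.support_const_smul_subset c (v k)
  · exact key w v _ (fun k x => rfl) hvw
  · exact key G (fun k => gradient (v k)) _ hgrad hvG
  · calc ∫ x in Ω, ⟪(c • G : Lp (Space d) 2 (volume.restrict Ω)) x, gradient u x⟫
        = ∫ x in Ω, c * ⟪G x, gradient u x⟫ := by
          refine integral_congr_ae ?_
          filter_upwards [Lp.coeFn_smul c G] with x hx
          rw [hx, Pi.smul_apply, real_inner_smul_left]
      _ = ∫ x in Ω, c * (g x * u x) := by
          rw [integral_const_mul, hG u hu, integral_const_mul]
      _ = _ := by
          refine integral_congr_ae ?_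
          filter_upwards [Lp.coeFn_smul c g] with x hx
          rw [hx, Pi.smul_apply, smul_eq_mul, mul_assoc]

theorem IsDirichletEigensystem.pos {lam : ℕ → ℝ} {φ : HilbertBasis ℕ ℝ (L2 Ω)}
    (h : IsDirichletEigensystem Ω lam φ) (hd : 1 ≤ d) (hΩ : Bornology.IsBounded Ω) (n : ℕ) :
    0 < lam n := by
  obtain ⟨R, hR⟩ := hΩ.exists_norm_le
  have h1 := (h.eigen n).norm_sq_le hd hR
  rw [real_inner_smul_left, real_inner_self_eq_norm_sq, φ.orthonormal.1 n] at h1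
  by_contra hneg
  nlinarith [sq_nonneg R]

/-- The Fourier coefficients of the final state of a weak solution. -/
theorem IsWeakSolution.inner_final_eq {lam : ℕ → ℝ} {φ : HilbertBasis ℕ ℝ (L2 Ω)}
    (h : IsDirichletEigensystem Ω lam φ) {τ : ℝ} {ψ : ℝ → ℝ} (hτ : 0 < τ)
    (hψ : ContinuousOn ψ (Icc 0 τ)) {f : L2 Ω} {u : ℝ → L2 Ω} (hu : IsWeakSolution Ω τ ψ f u)
    (n : ℕ) : ⟪u τ, φ n⟫ = mu τ ψ lam n * ⟪f, φ n⟫ := by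
  obtain ⟨y', y'', z', hy'0, hy⟩ := hu.equation (φ n) _ _ (h.eigen n)
    ((h.eigen n).const_smul (lam n))
  refine eq_integral_kernel_mul_of_hasDerivWithinAt (y := fun s => ⟪u s, φ n⟫) hτ hψ
    (by simp [hu.initial]) hy'0 (fun t ht => (hy t ht).1) (fun t ht => (hy t ht).2.1)
    fun t ht => ?_
  obtain ⟨h1, -, h3, h4⟩ := hy t ht
  simp only [real_inner_smul_right] at h3 h4
  have h5 : z' t = lam n * y' t :=
    (uniqueDiffOn_Icc hτ t ht).eq_deriv _ h3 (h1.const_mul (lam n))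
  rw [← h4, h5]
  ring

end Dirichlet

end Biparabolic

namespace Biparabolic

/-! ### Power inequalities and the parameter choice -/

section Rpow

theorem rpow_le_one_add_rpow {y q b : ℝ} (hy : 0 < y) (hq : 0 ≤ q) (hqb : q ≤ b) :
    y ^ q ≤ 1 + y ^ b := by
  have hyb : 0 < y ^ b := Real.rpow_pos_of_pos hy b
  rcases le_total y 1 with h | h
  · linarith [Real.rpow_le_one hy.le h hq]
  · linarith [Real.rpow_le_rpow_of_exponent_le h hqb]

/-- Rescaling by `y = α^(1/b) l` reduces this to the case `α = 1`. -/
theorem rpow_le_one_add_mul_rpow {l α q b : ℝ} (hl : 0 < l) (hα : 0 < α) (hb : 0 < b)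
    (hq : 0 ≤ q) (hqb : q ≤ b) : l ^ q ≤ (1 + α * l ^ b) * α ^ (-q / b) := by
  have h := rpow_le_one_add_rpow (y := α ^ (1 / b) * l) (by positivity) hq hqb
  rw [Real.mul_rpow (by positivity) hl.le, Real.mul_rpow (by positivity) hl.le,
    ← Real.rpow_mul hα.le, ← Real.rpow_mul hα.le, one_div_mul_cancel hb.ne', Real.rpow_one] at h
  calc l ^ q = α ^ (1 / b * q) * l ^ q * α ^ (-q / b) := by
        rw [mul_right_comm, ← Real.rpow_add hα]
        have : 1 / b * q + -q / b = 0 := by ring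
        rw [this, Real.rpow_zero, one_mul]
    _ ≤ _ := by gcongr

theorem mul_rpow_le_one_add_mul_rpow {l α p b : ℝ} (hl : 0 < l) (hα : 0 < α) (hp : 0 < p)
    (hpb : p ≤ b) : α * l ^ b ≤ (1 + α * l ^ b) * (α ^ (p / b) * l ^ p) := by
  have hb : 0 < b := hp.trans_le hpb
  have h := rpow_le_one_add_mul_rpow hl hα hb (sub_nonneg.mpr hpb) (sub_le_self b hp.le)
  have h1 : l ^ b = l ^ (b - p) * l ^ p := by rw [← Real.rpow_add hl, sub_add_cancel]
  have h2 : α ^ (p / b) = α * α ^ (-(b - p) / b) := by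
    nth_rewrite 2 [← Real.rpow_one α]
    rw [← Real.rpow_add hα]
    congr 1
    field_simp
    ring
  calc α * l ^ b = α * l ^ (b - p) * l ^ p := by rw [h1, mul_assoc]
    _ ≤ α * ((1 + α * l ^ b) * α ^ (-(b - p) / b)) * l ^ p := by gcongr
    _ = _ := by rw [h2]; ring

/-- With `α` of order `(δ/ϱ)^(b/(q+2))`, both `α^(q/b) ϱ` and `α^(-2/b) δ` have order `ϱ^(2/(q+2))
δ^(q/(q+2))`. The first needs the upper bound on `α`, the second (next lemma) the lower one. It is
used with `q = p` and `q = b`. -/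
theorem rpow_mul_le_of_le {α c q b δ ϱ : ℝ} (hα : 0 < α) (hc : 0 < c) (hq : 0 < q) (hb : 0 < b)
    (hδ : 0 < δ) (hϱ : 0 < ϱ) (h : α ≤ c * (δ / ϱ) ^ (b / (q + 2))) :
    α ^ (q / b) * ϱ ≤ c ^ (q / b) * (ϱ ^ (2 / (q + 2)) * δ ^ (q / (q + 2))) := by
  have h1 : b / (q + 2) * (q / b) = q / (q + 2) := by field_simp
  have h2 : ϱ = ϱ ^ (q / (q + 2)) * ϱ ^ (2 / (q + 2)) := by
    rw [← Real.rpow_add hϱ, ← add_div, div_self (by positivity), Real.rpow_one]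
  calc α ^ (q / b) * ϱ ≤ (c * (δ / ϱ) ^ (b / (q + 2))) ^ (q / b) * ϱ := by gcongr
    _ = c ^ (q / b) * (δ ^ (q / (q + 2)) / ϱ ^ (q / (q + 2))) *
        (ϱ ^ (q / (q + 2)) * ϱ ^ (2 / (q + 2))) := by
        rw [← h2, Real.mul_rpow hc.le (by positivity), ← Real.rpow_mul (by positivity), h1,
          Real.div_rpow hδ.le hϱ.le]
    _ = _ := by
        have : ϱ ^ (q / (q + 2)) ≠ 0 := (Real.rpow_pos_of_pos hϱ _).ne'
        field_simp

theorem rpow_neg_mul_le_of_le {α c q b δ ϱ : ℝ} (hc : 0 < c) (hq : 0 < q)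
    (hb : 0 < b) (hδ : 0 < δ) (hϱ : 0 < ϱ) (h : c * (δ / ϱ) ^ (b / (q + 2)) ≤ α) :
    α ^ (-2 / b) * δ ≤ c ^ (-2 / b) * (ϱ ^ (2 / (q + 2)) * δ ^ (q / (q + 2))) := by
  have h1 : b / (q + 2) * (-2 / b) = -(2 / (q + 2)) := by field_simp
  have h2 : δ = δ ^ (q / (q + 2)) * δ ^ (2 / (q + 2)) := by
    rw [← Real.rpow_add hδ, ← add_div, div_self (by positivity), Real.rpow_one]
  have h3 : -2 / b ≤ 0 := div_nonpos_of_nonpos_of_nonneg (by norm_num) hb.le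
  calc α ^ (-2 / b) * δ ≤ (c * (δ / ϱ) ^ (b / (q + 2))) ^ (-2 / b) * δ := by
        gcongr ?_ * _
        exact Real.rpow_le_rpow_of_nonpos (by positivity) h h3
    _ = c ^ (-2 / b) * (ϱ ^ (2 / (q + 2)) / δ ^ (2 / (q + 2))) *
        (δ ^ (q / (q + 2)) * δ ^ (2 / (q + 2))) := by
        rw [← h2, Real.mul_rpow hc.le (by positivity), ← Real.rpow_mul (by positivity), h1,
          Real.rpow_neg (by positivity), Real.div_rpow hδ.le hϱ.le, inv_div]
    _ = _ := by
        have : δ ^ (2 / (q + 2)) ≠ 0 := (Real.rpow_pos_of_pos hδ _).ne'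
        field_simp

end Rpow

/-! ### The symbol of `T_α`, its inverse and the error estimate -/

section QuasiReversibility

variable {d : ℕ} {Ω : Set (Space d)} {lam : ℕ → ℝ} {φ : HilbertBasis ℕ ℝ (L2 Ω)}
  {τ : ℝ} {ψ : ℝ → ℝ} {b α C : ℝ}

theorem IsLowerConstant.le_abs_symbol (hC : IsLowerConstant τ ψ lam C) (hlam : ∀ n, 0 < lam n)
    (hα : 0 < α) (n : ℕ) :
    C * (1 + α * lam n ^ b) ≤ lam n ^ 2 * |(1 + α * lam n ^ b) * mu τ ψ lam n| := by
  have hl := hlam n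
  have h := hC.2 n
  rw [div_le_iff₀ (by positivity)] at h
  rw [abs_mul, abs_of_pos (by positivity : 0 < 1 + α * lam n ^ b)]
  calc C * (1 + α * lam n ^ b) ≤ |mu τ ψ lam n| * lam n ^ 2 * (1 + α * lam n ^ b) := by gcongr
    _ = _ := by ring

/-- This is the norm bound for `T_α⁻¹`: `b ≥ 2` lets `1 + α λ^b` absorb the factor `λ²` lost in
inverting `μ_n`. -/
theorem IsLowerConstant.one_le_mul_abs_symbol (hC : IsLowerConstant τ ψ lam C)
    (hlam : ∀ n, 0 < lam n) (hb : 2 ≤ b) (hα : 0 < α) (n : ℕ) :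
    1 ≤ α ^ (-2 / b) / C * |(1 + α * lam n ^ b) * mu τ ψ lam n| := by
  have hl := hlam n
  have hCpos := hC.1
  have h1 := hC.le_abs_symbol (b := b) hlam hα n
  have h2 := rpow_le_one_add_mul_rpow hl hα (by linarith) zero_le_two hb
  rw [Real.rpow_two] at h2
  have h3 : 0 < 1 + α * lam n ^ b := by positivity
  rw [div_mul_eq_mul_div, le_div_iff₀ hC.1, one_mul]
  refine le_of_mul_le_mul_left ?_ h3
  calc (1 + α * lam n ^ b) * C = C * (1 + α * lam n ^ b) := mul_comm _ _
    _ ≤ lam n ^ 2 * |(1 + α * lam n ^ b) * mu τ ψ lam n| := h1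
    _ ≤ (1 + α * lam n ^ b) * α ^ (-2 / b) * |(1 + α * lam n ^ b) * mu τ ψ lam n| := by gcongr
    _ = _ := by ring

theorem IsLowerConstant.symbol_ne_zero (hC : IsLowerConstant τ ψ lam C)
    (hlam : ∀ n, 0 < lam n) (hb : 2 ≤ b) (hα : 0 < α) (n : ℕ) :
    (1 + α * lam n ^ b) * mu τ ψ lam n ≠ 0 := by
  intro h
  have h1 := hC.one_le_mul_abs_symbol hlam hb hα n
  rw [h, abs_zero, mul_zero] at h1
  linarith

/-- Dropping the `1` in `1 + α λ^b` gives the gain of regularity that puts preimages in `ℍ_{b-2}`.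
-/
theorem IsLowerConstant.rpow_le_mul_abs_symbol (hC : IsLowerConstant τ ψ lam C)
    (hlam : ∀ n, 0 < lam n) (hα : 0 < α) (n : ℕ) :
    lam n ^ (b - 2) ≤ 1 / (C * α) * |(1 + α * lam n ^ b) * mu τ ψ lam n| := by
  have hl := hlam n
  have hCpos := hC.1
  have h1 := hC.le_abs_symbol (b := b) hlam hα n
  have h2 : lam n ^ b = lam n ^ 2 * lam n ^ (b - 2) := by
    rw [← Real.rpow_two, ← Real.rpow_add hl, add_sub_cancel]
  rw [one_div_mul_eq_div, le_div_iff₀ (by positivity)]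
  refine le_of_mul_le_mul_left (le_trans ?_ h1) (by positivity : 0 < lam n ^ 2)
  calc lam n ^ 2 * (lam n ^ (b - 2) * (C * α)) = C * (α * lam n ^ b) := by rw [h2]; ring
    _ ≤ C * (1 + α * lam n ^ b) := by gcongr; linarith

theorem exists_abs_symbol_le (hτ : 0 < τ) (hψ : ContinuousOn ψ (Icc 0 τ)) {l₀ : ℝ} (hl₀ : 0 < l₀)
    (hlam : ∀ n, l₀ ≤ lam n) (hb : 0 ≤ b) (hα : 0 < α) :
    ∃ A : ℝ, ∀ n, |(1 + α * lam n ^ b) * mu τ ψ lam n| ≤ A * lam n ^ (b - 2) := by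
  obtain ⟨K, hK, hmu⟩ := exists_abs_mu_le hτ hψ
  refine ⟨(1 / l₀ ^ b + α) * K, fun n => ?_⟩
  have hl : 0 < lam n := hl₀.trans_le (hlam n)
  have h1 : 1 ≤ 1 / l₀ ^ b * lam n ^ b := by
    rw [one_div_mul_eq_div, one_le_div (by positivity)]
    exact Real.rpow_le_rpow hl₀.le (hlam n) hb
  rw [abs_mul, abs_of_pos (by positivity : 0 < 1 + α * lam n ^ b)]
  calc (1 + α * lam n ^ b) * |mu τ ψ lam n|
      ≤ (1 / l₀ ^ b * lam n ^ b + α * lam n ^ b) * (K / lam n ^ 2) := by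
        gcongr
        exact hmu lam n hl
    _ = (1 / l₀ ^ b + α) * K * (lam n ^ b / lam n ^ 2) := by ring
    _ = _ := by rw [Real.rpow_sub hl, Real.rpow_two]

theorem rpow_two_mul_eq_sq {l : ℝ} (hl : 0 < l) (q : ℝ) : l ^ (2 * q) = (l ^ q) ^ 2 := by
  rw [mul_comm, Real.rpow_mul hl.le, Real.rpow_two]

theorem inner_qrmOperator (hτ : 0 < τ) (hψ : ContinuousOn ψ (Icc 0 τ)) {l₀ : ℝ} (hl₀ : 0 < l₀)
    (hlam : ∀ n, l₀ ≤ lam n) (hb : 0 ≤ b) (hα : 0 < α) {g : L2 Ω}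
    (hg : g ∈ scaleSpace lam φ (b - 2)) (n : ℕ) :
    ⟪qrmOperator lam φ τ ψ b α g, φ n⟫ = (1 + α * lam n ^ b) * mu τ ψ lam n * ⟪g, φ n⟫ := by
  obtain ⟨A, hA⟩ := exists_abs_symbol_le (b := b) hτ hψ hl₀ hlam hb hα
  obtain ⟨k, hk⟩ := exists_inner_eq φ
    (fun n => (1 + α * lam n ^ b) * mu τ ψ lam n * ⟪g, φ n⟫) (by
      refine Summable.of_nonneg_of_le (fun n => sq_nonneg _) (fun n => ?_)
        (Summable.mul_left (A ^ 2) hg)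
      calc ((1 + α * lam n ^ b) * mu τ ψ lam n * ⟪g, φ n⟫) ^ 2
          = |(1 + α * lam n ^ b) * mu τ ψ lam n| ^ 2 * ⟪g, φ n⟫ ^ 2 := by rw [sq_abs, mul_pow]
        _ ≤ (A * lam n ^ (b - 2)) ^ 2 * ⟪g, φ n⟫ ^ 2 := by gcongr; exact hA n
        _ = A ^ 2 * (lam n ^ (2 * (b - 2)) * ⟪g, φ n⟫ ^ 2) := by
          rw [rpow_two_mul_eq_sq (hl₀.trans_le (hlam n)), mul_pow, mul_assoc])
  rw [qrmOperator, tsum_smul_eq_of_inner_eq φ hk, hk]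

theorem IsLowerConstant.bijOn_qrmOperator (hC : IsLowerConstant τ ψ lam C) (hτ : 0 < τ)
    (hψ : ContinuousOn ψ (Icc 0 τ)) {l₀ : ℝ} (hl₀ : 0 < l₀) (hlam : ∀ n, l₀ ≤ lam n)
    (hb : 2 ≤ b) (hα : 0 < α) :
    BijOn (qrmOperator lam φ τ ψ b α) (scaleSpace lam φ (b - 2)) univ := by
  have hpos : ∀ n, 0 < lam n := fun n => hl₀.trans_le (hlam n)
  have hb0 : 0 ≤ b := by linarith
  have hne := hC.symbol_ne_zero hpos hb hα
  refine ⟨fun _ _ => mem_univ _, fun g hg k hk hgk => ?_, fun h _ => ?_⟩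
  · refine eq_of_inner_eq φ fun n => mul_left_cancel₀ (hne n) ?_
    rw [← inner_qrmOperator hτ hψ hl₀ hlam hb0 hα hg,
      ← inner_qrmOperator hτ hψ hl₀ hlam hb0 hα hk, hgk]
  · have hsum := (hasSum_inner_sq φ h).summable
    -- Used with `x = 1` for square summability of the quotients, and with `x = λ^(b-2)` for
    -- membership in `ℍ_{b-2}`.
    have key : ∀ {x B m y : ℝ}, 0 ≤ x → m ≠ 0 → x ≤ B * |m| →
        x ^ 2 * (y / m) ^ 2 ≤ B ^ 2 * y ^ 2 := by
      intro x B m y hx hm hle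
      calc x ^ 2 * (y / m) ^ 2 ≤ (B * |m|) ^ 2 * (y / m) ^ 2 := by gcongr
        _ = B ^ 2 * y ^ 2 := by
          rw [mul_pow, sq_abs]
          field_simp
    obtain ⟨g, hg⟩ := exists_inner_eq φ
      (fun n => ⟪h, φ n⟫ / ((1 + α * lam n ^ b) * mu τ ψ lam n)) (by
        refine Summable.of_nonneg_of_le (fun n => sq_nonneg _) (fun n => ?_)
          (hsum.mul_left ((α ^ (-2 / b) / C) ^ 2))
        simpa using key (y := ⟪h, φ n⟫) zero_le_one (hne n)
          (hC.one_le_mul_abs_symbol hpos hb hα n))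
    have hmem : g ∈ scaleSpace lam φ (b - 2) := by
      refine Summable.of_nonneg_of_le
        (fun n => mul_nonneg (Real.rpow_nonneg (hpos n).le _) (sq_nonneg _)) (fun n => ?_)
        (hsum.mul_left ((1 / (C * α)) ^ 2))
      rw [rpow_two_mul_eq_sq (hpos n), hg]
      exact key (Real.rpow_nonneg (hpos n).le _) (hne n) (hC.rpow_le_mul_abs_symbol hpos hα n)
    refine ⟨g, hmem, eq_of_inner_eq φ fun n => ?_⟩
    rw [inner_qrmOperator hτ hψ hl₀ hlam hb0 hα hmem, hg, mul_div_cancel₀ _ (hne n)]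

/-- The error splits into a regularization error, controlled by the source condition through a
bound `A` on the symbol of the regularization, and a propagated data error. -/
theorem IsLowerConstant.norm_sub_qrmApprox_le (hC : IsLowerConstant τ ψ lam C) (hτ : 0 < τ)
    (hψ : ContinuousOn ψ (Icc 0 τ)) {l₀ : ℝ} (hl₀ : 0 < l₀) (hlam : ∀ n, l₀ ≤ lam n)
    (hb : 2 ≤ b) (hα : 0 < α) {A p ϱ : ℝ} (hA : 0 ≤ A) (hϱ : 0 ≤ ϱ)
    (hAp : ∀ n, α * lam n ^ b ≤ (1 + α * lam n ^ b) * (A * lam n ^ p))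
    {f h k : L2 Ω} (hf : f ∈ sourceSet lam φ ϱ p)
    (hh : ∀ n, ⟪h, φ n⟫ = mu τ ψ lam n * ⟪f, φ n⟫) :
    ‖f - qrmApprox lam φ τ ψ b α k‖ ≤ A * ϱ + α ^ (-2 / b) / C * ‖h - k‖ := by
  have hpos : ∀ n, 0 < lam n := fun n => hl₀.trans_le (hlam n)
  have hne := hC.symbol_ne_zero hpos hb hα
  have hCpos := hC.1
  have hbij := hC.bijOn_qrmOperator (φ := φ) hτ hψ hl₀ hlam hb hα
  set g := qrmApprox lam φ τ ψ b α k with hgdef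
  have hg : g ∈ scaleSpace lam φ (b - 2) := Function.invFunOn_mem (hbij.surjOn (mem_univ k))
  have hgk : qrmOperator lam φ τ ψ b α g = k := Function.invFunOn_eq (hbij.surjOn (mem_univ k))
  -- `e = T_α⁻¹ (h - k)` is the propagated data error, and `f - g - e` stands for `f - T_α⁻¹ h`. As
  -- `f` need not lie in `ℍ_{b-2}`, the comparison is made on coefficients rather than by applying
  -- `T_α` to `f`.
  obtain ⟨e, hemem, he⟩ := hbij.surjOn (mem_univ (h - k))
  have hcoef := fun {x : L2 Ω} (hx : x ∈ scaleSpace lam φ (b - 2)) =>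
    inner_qrmOperator hτ hψ hl₀ hlam (by linarith) hα hx
  have hdata : ‖e‖ ≤ α ^ (-2 / b) / C * ‖h - k‖ := by
    refine norm_le_of_abs_inner_le φ (by positivity) fun n => ?_
    rw [← he, hcoef hemem, abs_mul, ← mul_assoc]
    exact le_mul_of_one_le_left (abs_nonneg _) (hC.one_le_mul_abs_symbol hpos hb hα n)
  have hreg : ‖f - g - e‖ ≤ A * ϱ := by
    refine norm_le_of_inner_sq_le φ hA hϱ hf.1 hf.2 fun n => ?_
    have hl := hpos n
    have h1 : 0 < 1 + α * lam n ^ b := by positivity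
    have h2 : (1 + α * lam n ^ b) * ⟪f - g - e, φ n⟫ = α * lam n ^ b * ⟪f, φ n⟫ := by
      have h3 := hcoef hemem n
      have h4 := hcoef hg n
      rw [he, inner_sub_left, hh] at h3
      rw [hgk] at h4
      have hmu : mu τ ψ lam n ≠ 0 := right_ne_zero_of_mul (hne n)
      rw [inner_sub_left, inner_sub_left]
      refine mul_left_cancel₀ hmu ?_
      linear_combination h3 + h4
    have h5 : |⟪f - g - e, φ n⟫| ≤ A * lam n ^ p * |⟪f, φ n⟫| := by
      refine le_of_mul_le_mul_left ?_ h1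
      calc (1 + α * lam n ^ b) * |⟪f - g - e, φ n⟫|
          = |(1 + α * lam n ^ b) * ⟪f - g - e, φ n⟫| := by rw [abs_mul, abs_of_pos h1]
        _ = α * lam n ^ b * |⟪f, φ n⟫| := by rw [h2, abs_mul, abs_of_pos (by positivity)]
        _ ≤ (1 + α * lam n ^ b) * (A * lam n ^ p) * |⟪f, φ n⟫| := by
          gcongr ?_ * _
          exact hAp n
        _ = _ := by ring
    calc ⟪f - g - e, φ n⟫ ^ 2 = |⟪f - g - e, φ n⟫| ^ 2 := (sq_abs _).symm
      _ ≤ (A * lam n ^ p * |⟪f, φ n⟫|) ^ 2 := by gcongr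
      _ = _ := by rw [rpow_two_mul_eq_sq hl, mul_pow, mul_pow, sq_abs, mul_assoc]
  calc ‖f - g‖ = ‖(f - g - e) + e‖ := by rw [sub_add_cancel]
    _ ≤ ‖f - g - e‖ + ‖e‖ := norm_add_le _ _
    _ ≤ _ := add_le_add hreg hdata

end QuasiReversibility

end Biparabolic

theorem theorem4p2 (b p : ℝ) (hb : 2 ≤ b) (hp : 0 < p)
    (c₁ c₂ : ℝ) (hc₁ : 0 < c₁) (hc : c₁ ≤ c₂) :
    ∃ (C₁ : ℝ → ℝ) (C₂ : ℝ → ℝ → ℝ),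
      (∀ C > 0, 0 < C₁ C) ∧ (∀ C > 0, ∀ l > 0, 0 < C₂ C l) ∧
      ∀ (d : ℕ) (Ω : Set (Biparabolic.Space d)), 1 ≤ d →
        Biparabolic.IsBoundedLipschitzDomain Ω →
      ∀ (lam : ℕ → ℝ) (φ : HilbertBasis ℕ ℝ (Biparabolic.L2 Ω)),
        Biparabolic.IsDirichletEigensystem Ω lam φ →
      ∀ (τ : ℝ) (ψ : ℝ → ℝ), 0 < τ → ContinuousOn ψ (Icc 0 τ) →
        Biparabolic.TimeFactorAssumption τ ψ →
      (∃ C, Biparabolic.IsLowerConstant τ ψ lam C) ∧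
      (∀ α > 0, BijOn (Biparabolic.qrmOperator lam φ τ ψ b α)
        (Biparabolic.scaleSpace lam φ (b - 2)) univ) ∧
      ∀ C, Biparabolic.IsLowerConstant τ ψ lam C →
      ∀ ϱ > 0, ∀ δ > 0, ∀ α > 0,
      ∀ f ∈ Biparabolic.sourceSet lam φ ϱ p,
      ∀ u : ℝ → Biparabolic.L2 Ω, Biparabolic.IsWeakSolution Ω τ ψ f u →
      ∀ hδ : Biparabolic.L2 Ω, ‖u τ - hδ‖ ≤ δ →
        (p < b →
          c₁ * (δ / ϱ) ^ (b / (p + 2)) ≤ α → α ≤ c₂ * (δ / ϱ) ^ (b / (p + 2)) →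
          ‖f - Biparabolic.qrmApprox lam φ τ ψ b α hδ‖
            ≤ C₁ C * ϱ ^ (2 / (p + 2)) * δ ^ (p / (p + 2))) ∧
        (b ≤ p →
          c₁ * (δ / ϱ) ^ (b / (b + 2)) ≤ α → α ≤ c₂ * (δ / ϱ) ^ (b / (b + 2)) →
          ‖f - Biparabolic.qrmApprox lam φ τ ψ b α hδ‖
            ≤ C₂ C (lam 0) * ϱ ^ (2 / (b + 2)) * δ ^ (b / (b + 2))) := by
  have hb0 : 0 < b := by linarith
  have hc₂ : 0 < c₂ := hc₁.trans_le hc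
  -- In each constant the first term comes from the regularization error and the second from the
  -- data error. The exponent `b / b` is left unsimplified to match the balancing lemma at `q = b`.
  refine ⟨fun C => c₂ ^ (p / b) + c₁ ^ (-2 / b) / C,
    fun C l => c₂ ^ (b / b) * l ^ (b - p) + c₁ ^ (-2 / b) / C,
    fun C hC => by positivity, fun C hC l hl => by positivity, ?_⟩
  intro d Ω hd hΩ lam φ hφ τ ψ hτ hψ hfac
  have hl₀ : 0 < lam 0 := hφ.pos hd hΩ.isBounded 0
  have hlam : ∀ n, lam 0 ≤ lam n := fun n => hφ.mono (Nat.zero_le n)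
  have hpos : ∀ n, 0 < lam n := fun n => hl₀.trans_le (hlam n)
  obtain ⟨C₀, hC₀⟩ := hfac.exists_isLowerConstant hτ hψ hl₀ hlam
  refine ⟨⟨C₀, hC₀⟩, fun α hα => hC₀.bijOn_qrmOperator hτ hψ hl₀ hlam hb hα, ?_⟩
  intro C hC ϱ hϱ δ hδ α hα f hf u hu hδ' hdist
  have hCpos := hC.1
  have hu' := hu.inner_final_eq hφ hτ hψ
  have hdata : α ^ (-2 / b) / C * ‖u τ - hδ'‖ ≤ α ^ (-2 / b) * δ / C := by
    rw [div_mul_eq_mul_div]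
    gcongr
  constructor
  · intro hpb h1 h2
    have hA := fun n => Biparabolic.mul_rpow_le_one_add_mul_rpow (hpos n) hα hp hpb.le
    calc ‖f - Biparabolic.qrmApprox lam φ τ ψ b α hδ'‖
        ≤ α ^ (p / b) * ϱ + α ^ (-2 / b) / C * ‖u τ - hδ'‖ :=
          hC.norm_sub_qrmApprox_le hτ hψ hl₀ hlam hb hα (by positivity) hϱ.le hA hf hu'
      _ ≤ c₂ ^ (p / b) * (ϱ ^ (2 / (p + 2)) * δ ^ (p / (p + 2))) +
          c₁ ^ (-2 / b) * (ϱ ^ (2 / (p + 2)) * δ ^ (p / (p + 2))) / C := by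
          refine add_le_add (Biparabolic.rpow_mul_le_of_le hα hc₂ hp hb0 hδ hϱ h2)
            (hdata.trans ?_)
          gcongr ?_ / _
          exact Biparabolic.rpow_neg_mul_le_of_le hc₁ hp hb0 hδ hϱ h1
      _ = _ := by ring
  · intro hbp h1 h2
    -- Saturation: for `p ≥ b` the power of `α` cannot exceed `1` in this bound, and the surplus
    -- smoothness is spent through `λ_n^(b-p) ≤ λ_1^(b-p)`; this is where `λ_1` enters the constant.
    have hA : ∀ n, α * lam n ^ b ≤
        (1 + α * lam n ^ b) * (α ^ (b / b) * lam 0 ^ (b - p) * lam n ^ p) := by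
      intro n
      have hl := hpos n
      have h3 : lam n ^ (b - p) ≤ lam 0 ^ (b - p) :=
        Real.rpow_le_rpow_of_nonpos hl₀ (hlam n) (by linarith)
      have h4 : lam n ^ b = lam n ^ (b - p) * lam n ^ p := by
        rw [← Real.rpow_add hl, sub_add_cancel]
      rw [div_self hb0.ne', Real.rpow_one]
      calc α * lam n ^ b = α * lam n ^ (b - p) * lam n ^ p := by rw [h4, mul_assoc]
        _ ≤ α * lam 0 ^ (b - p) * lam n ^ p := by gcongr
        _ ≤ _ := le_mul_of_one_le_left (by positivity) (by
          have : 0 < α * lam n ^ b := by positivity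
          linarith)
    calc ‖f - Biparabolic.qrmApprox lam φ τ ψ b α hδ'‖
        ≤ α ^ (b / b) * lam 0 ^ (b - p) * ϱ + α ^ (-2 / b) / C * ‖u τ - hδ'‖ :=
          hC.norm_sub_qrmApprox_le hτ hψ hl₀ hlam hb hα (by positivity) hϱ.le hA hf hu'
      _ = lam 0 ^ (b - p) * (α ^ (b / b) * ϱ) + α ^ (-2 / b) / C * ‖u τ - hδ'‖ := by ring
      _ ≤ lam 0 ^ (b - p) * (c₂ ^ (b / b) * (ϱ ^ (2 / (b + 2)) * δ ^ (b / (b + 2)))) +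
          c₁ ^ (-2 / b) * (ϱ ^ (2 / (b + 2)) * δ ^ (b / (b + 2))) / C := by
          refine add_le_add (mul_le_mul_of_nonneg_left
            (Biparabolic.rpow_mul_le_of_le hα hc₂ hb0 hb0 hδ hϱ h2) (by positivity))
            (hdata.trans ?_)
          gcongr ?_ / _
          exact Biparabolic.rpow_neg_mul_le_of_le hc₁ hb0 hb0 hδ hϱ h1
      _ = _ := by ring
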